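/- Let $(M,\omega)$ be a four-dimensional symplectic manifold, let $\rho_1\neq\rho_2$ be two commuting antisymplectic involutions of $M$ (smooth, $\rho_i^2=\mathrm{id}$, $\rho_i^*\omega=-\omega$), and let $H\colon M\to\mathbb R$ be smooth with $H\circ\rho_1=H=H\circ\rho_2$. The Hamiltonian vector field $X_H$ is defined by $dH=\omega(\cdot,X_H)$ and its flow is denoted $\phi_H^t$. A periodic orbit is a nonconstant solution $v\colon\mathbb R\to M$ of $\dot v=X_H(v)$ together with a period $\tau>0$, $v(t+\tau)=v(t)$ (not necessarily the minimal period); orbits that differ only by a shift of time are identified when orbits are counted. It is simple if $v$ is injective on $[0,\tau)$, and its $k$-fold cover ($k\ge 1$) is the same curve with period $k\tau$. A simple periodic orbit is doubly symmetric if $\rho_1(v(-t))=v(t)$ for all $t$ and $\rho_2(v(0))=v(\tau/2)$; a periodic orbit is called doubly symmetric if it is a simple doubly symmetric orbit or a multiple cover of one. With $\Sigma$ the energy level through $v(0)$, the reduced monodromy is the linear map $$M_v=\overline{d\phi_H^\tau(v(0))}\colon T_{v(0)}\Sigma/\langle X_H(v(0))\rangle\to T_{v(0)}\Sigma/\langle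 X_H(v(0))\rangle .$$ The orbit is positive hyperbolic if $\mathrm{tr}\,M_v>2$, negative hyperbolic if $\mathrm{tr}\,M_v<-2$, and elliptic if $-2\le\mathrm{tr}\,M_v\le 2$. An even cover of a negative hyperbolic orbit is bad; every other periodic orbit is good. The SFT-Euler characteristic of a finite collection of periodic orbits is $$\chi_{SFT}=\#\{\text{good positive hyperbolic orbits}\}-\#\{\text{elliptic or negative hyperbolic orbits}\}.$$ Corollary E. Every finite collection of doubly symmetric periodic orbits with $\chi_{SFT}<0$ contains a stable orbit, i.e. an elliptic one; in particular all complex eigenvalues of its reduced monodromy lie on the unit circle. -/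

import Mathlib

open scoped Manifold ContDiff

noncomputable section

namespace DoublySymmetric

/-- The model space of four-dimensional manifolds. -/
abbrev E4 : Type := EuclideanSpace ℝ (Fin 4)

section Symplectic

variable {M : Type*} [TopologicalSpace M] [ChartedSpace E4 M]

/-- The expression, in the chart around `x₀`, of a field `Ω` of bilinear forms on the tangent
spaces of `M`, that is, its pullback under the inverse of that chart. -/
def chartForm (Ω : ∀ x : M, TangentSpace (𝓡 4) x →L[ℝ] TangentSpace (𝓡 4) x →L[ℝ] ℝ)
    (x₀ : M) (y : E4) : E4 →L[ℝ] E4 →L[ℝ] ℝ :=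
  let B : E4 →L[ℝ] E4 →L[ℝ] ℝ := Ω ((extChartAt (𝓡 4) x₀).symm y)
  let D : E4 →L[ℝ] E4 := mfderiv 𝓘(ℝ, E4) (𝓡 4) (extChartAt (𝓡 4) x₀).symm y
  B.bilinearComp D D

end Symplectic

/-- A symplectic form on a four-dimensional manifold: a smooth, closed, nondegenerate 2-form. -/
structure SymplecticForm (M : Type*) [TopologicalSpace M] [ChartedSpace E4 M] where
  /-- the bilinear form on each tangent space -/
  form : ∀ x : M, TangentSpace (𝓡 4) x →L[ℝ] TangentSpace (𝓡 4) x →L[ℝ] ℝ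
  alternating : ∀ (x : M) (u : TangentSpace (𝓡 4) x), form x u u = 0
  nondegenerate : ∀ (x : M) (u : TangentSpace (𝓡 4) x), (∀ w, form x w u = 0) → u = 0
  smooth : ∀ x₀ : M, ContDiffOn ℝ ∞ (chartForm form x₀) (extChartAt (𝓡 4) x₀).target
  /-- `dΩ = 0`, written out in the charts -/
  closed : ∀ (x₀ : M), ∀ y ∈ (extChartAt (𝓡 4) x₀).target, ∀ u v w : E4,
    fderiv ℝ (chartForm form x₀) y u v w + fderiv ℝ (chartForm form x₀) y v w u
      + fderiv ℝ (chartForm form x₀) y w u v = 0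

variable {M : Type*} [TopologicalSpace M] [ChartedSpace E4 M]

/-- The differential of a function, as a linear form on the tangent space. -/
def differential (H : M → ℝ) (x : M) : TangentSpace (𝓡 4) x →L[ℝ] ℝ :=
  mfderiv (𝓡 4) 𝓘(ℝ, ℝ) H x

/-- By nondegeneracy every linear form `α` on a tangent space is `Ω(·, X)` for some `X`. -/
theorem SymplecticForm.exists_dual (Ω : SymplecticForm M) (x : M)
    (α : TangentSpace (𝓡 4) x →L[ℝ] ℝ) :
    ∃ X : TangentSpace (𝓡 4) x, ∀ u, α u = Ω.form x u X := by
  have hfd : FiniteDimensional ℝ (TangentSpace (𝓡 4) x) :=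
    inferInstanceAs (FiniteDimensional ℝ E4)
  let L : TangentSpace (𝓡 4) x →ₗ[ℝ] Module.Dual ℝ (TangentSpace (𝓡 4) x) :=
    LinearMap.mk₂ ℝ (fun X u => Ω.form x u X)
      (by intros; simp) (by intros; simp) (by intros; simp) (by intros; simp)
  have hinj : Function.Injective L := by
    rw [injective_iff_map_eq_zero]
    intro X hX
    exact Ω.nondegenerate x X fun w => LinearMap.congr_fun hX w
  have hsurj : Function.Surjective L :=
    (LinearMap.injective_iff_surjective_of_finrank_eq_finrank
      (Subspace.dual_finrank_eq (K := ℝ)).symm).1 hinj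
  obtain ⟨X, hX⟩ := hsurj α.toLinearMap
  exact ⟨X, fun u => (LinearMap.congr_fun hX u).symm⟩

/-- The Hamiltonian vector field `X_H` of `H`, given by `dH = Ω(·, X_H)`. -/
def hamVF (Ω : SymplecticForm M) (H : M → ℝ) (x : M) : TangentSpace (𝓡 4) x :=
  (Ω.exists_dual x (differential H x)).choose

theorem hamVF_spec (Ω : SymplecticForm M) (H : M → ℝ) (x : M) (u : TangentSpace (𝓡 4) x) :
    differential H x u = Ω.form x u (hamVF Ω H x) :=
  (Ω.exists_dual x (differential H x)).choose_spec u

/-- `ρ` is an antisymplectic involution (a real structure): a smooth map with `ρ² = id` and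
`ρ^* Ω = -Ω`. -/
structure IsRealStructure (Ω : SymplecticForm M) (ρ : M → M) : Prop where
  smooth : ContMDiff (𝓡 4) (𝓡 4) ∞ ρ
  involutive : Function.Involutive ρ
  anti : ∀ (x : M) (u w : TangentSpace (𝓡 4) x),
    Ω.form (ρ x) (mfderiv (𝓡 4) (𝓡 4) ρ x u) (mfderiv (𝓡 4) (𝓡 4) ρ x w) = -Ω.form x u w

/-- A nonconstant, parametrized periodic orbit of `X_H` together with a period `τ > 0`. The orbit
may be multiply covered, that is, `τ` need not be the minimal period. -/
structure PeriodicOrbit (Ω : SymplecticForm M) (H : M → ℝ) where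
  /-- the orbit, as a periodic curve -/
  curve : ℝ → M
  /-- the period -/
  τ : ℝ
  τ_pos : 0 < τ
  isIntegralCurve : IsMIntegralCurve curve (hamVF Ω H)
  periodic : Function.Periodic curve τ
  nonconstant : ∃ t, curve t ≠ curve 0

/-- `φ` is a smooth local flow of the vector field `X`, defined for times in `(a, b)` and
initial points in the open set `U`. -/
structure IsLocalFlow (X : ∀ x : M, TangentSpace (𝓡 4) x) (a b : ℝ) (U : Set M)
    (φ : ℝ → M → M) : Prop where
  isOpen : IsOpen U
  zero_mem : (0 : ℝ) ∈ Set.Ioo a b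
  smooth : ContMDiffOn (𝓘(ℝ, ℝ).prod (𝓡 4)) (𝓡 4) ∞ (fun p : ℝ × M => φ p.1 p.2)
    (Set.Ioo a b ×ˢ U)
  map_zero : ∀ x ∈ U, φ 0 x = x
  isIntegralCurveOn : ∀ x ∈ U, IsMIntegralCurveOn (fun t => φ t x) X (Set.Ioo a b)

/-- The tangent space at `x` of the energy hypersurface `Σ` through `x` (where `dH ≠ 0`):
the kernel of `dH`. -/
def energyTangent (H : M → ℝ) (x : M) : Submodule ℝ (TangentSpace (𝓡 4) x) :=
  LinearMap.ker (differential H x).toLinearMap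

/-- The quotient `T_xΣ / ⟨X_H(x)⟩`. -/
abbrev ReducedSpace (Ω : SymplecticForm M) (H : M → ℝ) (x : M) : Type :=
  energyTangent H x ⧸
    (Submodule.span ℝ {hamVF Ω H x}).submoduleOf (energyTangent H x)

namespace PeriodicOrbit

variable {Ω : SymplecticForm M} {H : M → ℝ}

/-- The endomorphism `A` of the tangent space at `v(0)` is the unreduced monodromy
`dφ^τ_H(v(0))` of `v`, where `φ_H` is the flow of `X_H` near `v(0)` up to the time `τ`. -/
def IsUnreducedMonodromy (v : PeriodicOrbit Ω H)
    (A : TangentSpace (𝓡 4) (v.curve 0) →L[ℝ] TangentSpace (𝓡 4) (v.curve 0)) : Prop :=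
  ∃ (a b : ℝ) (U : Set M) (φ : ℝ → M → M),
    IsLocalFlow (hamVF Ω H) a b U φ ∧ v.τ ∈ Set.Ioo a b ∧ v.curve 0 ∈ U ∧
      HasMFDerivAt (𝓡 4) (𝓡 4) (φ v.τ) (v.curve 0) A

/-- The endomorphism `N` of `T_{v(0)}Σ / ⟨X_H(v(0))⟩` is the reduced monodromy `M_v` of `v`: it is
induced by the unreduced monodromy. -/
def IsReducedMonodromy (v : PeriodicOrbit Ω H)
    (N : ReducedSpace Ω H (v.curve 0) →ₗ[ℝ] ReducedSpace Ω H (v.curve 0)) : Prop :=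
  ∃ A : TangentSpace (𝓡 4) (v.curve 0) →L[ℝ] TangentSpace (𝓡 4) (v.curve 0),
    v.IsUnreducedMonodromy A ∧
    ∀ u : energyTangent H (v.curve 0), ∃ hu : A u ∈ energyTangent H (v.curve 0),
      N (Submodule.Quotient.mk u) = Submodule.Quotient.mk ⟨A u, hu⟩

/-- Positive hyperbolic: `tr M_v > 2`. -/
def IsPositiveHyperbolic (v : PeriodicOrbit Ω H) : Prop :=
  ∃ N, v.IsReducedMonodromy N ∧ 2 < LinearMap.trace ℝ (ReducedSpace Ω H (v.curve 0)) N

/-- Negative hyperbolic: `tr M_v < -2`. -/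
def IsNegativeHyperbolic (v : PeriodicOrbit Ω H) : Prop :=
  ∃ N, v.IsReducedMonodromy N ∧ LinearMap.trace ℝ (ReducedSpace Ω H (v.curve 0)) N < -2

/-- Elliptic: `-2 ≤ tr M_v ≤ 2`. -/
def IsElliptic (v : PeriodicOrbit Ω H) : Prop :=
  ∃ N, v.IsReducedMonodromy N ∧
    -2 ≤ LinearMap.trace ℝ (ReducedSpace Ω H (v.curve 0)) N ∧
    LinearMap.trace ℝ (ReducedSpace Ω H (v.curve 0)) N ≤ 2

/-- (Spectrally) stable: every complex eigenvalue of `M_v` lies on the unit circle. -/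
def IsStable (v : PeriodicOrbit Ω H) : Prop :=
  ∃ N, v.IsReducedMonodromy N ∧
    ∀ μ : ℂ, Module.End.HasEigenvalue (LinearMap.baseChange ℂ N) μ → ‖μ‖ = 1

/-- `v` is the `k`-fold cover of `w`. -/
def IsCover (k : ℕ) (v w : PeriodicOrbit Ω H) : Prop :=
  0 < k ∧ v.curve = w.curve ∧ v.τ = k * w.τ

/-- Bad: an even cover of a negative hyperbolic orbit. -/
def IsBad (v : PeriodicOrbit Ω H) : Prop :=
  ∃ (k : ℕ) (w : PeriodicOrbit Ω H), Even k ∧ v.IsCover k w ∧ w.IsNegativeHyperbolic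

/-- Good: not bad. -/
def IsGood (v : PeriodicOrbit Ω H) : Prop := ¬ v.IsBad

/-- Simple: injective on the circle `ℝ / τℤ`. -/
def IsSimple (v : PeriodicOrbit Ω H) : Prop := Set.InjOn v.curve (Set.Ico 0 v.τ)

/-- A simple periodic orbit that is symmetric with respect to `ρ₁`, i.e. `ρ₁(v(-t)) = v(t)`, and
doubly symmetric with respect to `ρ₂`, i.e. `ρ₂(v(0)) = v(τ/2)`. -/
structure IsSimpleDoublySymmetric (ρ₁ ρ₂ : M → M) (v : PeriodicOrbit Ω H) : Prop where
  simple : v.IsSimple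
  symmetric : ∀ t, ρ₁ (v.curve (-t)) = v.curve t
  doubly : ρ₂ (v.curve 0) = v.curve (v.τ / 2)

/-- A doubly symmetric periodic orbit: a simple one, or a multiple cover of a simple one. -/
def IsDoublySymmetric (ρ₁ ρ₂ : M → M) (v : PeriodicOrbit Ω H) : Prop :=
  ∃ (k : ℕ) (w : PeriodicOrbit Ω H), v.IsCover k w ∧ w.IsSimpleDoublySymmetric ρ₁ ρ₂

/-- Two parametrized periodic orbits are the same orbit if they have the same period and
differ by a shift of time. -/
def sameOrbit (Ω : SymplecticForm M) (H : M → ℝ) : Setoid (PeriodicOrbit Ω H) where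
  r v w := v.τ = w.τ ∧ ∃ s : ℝ, ∀ t, w.curve t = v.curve (t + s)
  iseqv :=
    { refl := fun _ => ⟨rfl, 0, fun t => by simp⟩
      symm := by
        rintro v w ⟨h, s, hs⟩
        exact ⟨h.symm, -s, fun t => by simp [hs]⟩
      trans := by
        rintro u v w ⟨h, s, hs⟩ ⟨h', s', hs'⟩
        exact ⟨h.trans h', s' + s, fun t => by rw [hs', hs, add_assoc]⟩ }

/-- The number of distinct (unparametrized) periodic orbits in the set `S`. -/
def orbitCount (S : Set (PeriodicOrbit Ω H)) : ℕ :=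
  (Quotient.mk (sameOrbit Ω H) '' S).ncard

/-- The SFT-Euler characteristic of a finite collection of periodic orbits. -/
def sftEulerChar (S : Set (PeriodicOrbit Ω H)) : ℤ :=
  (orbitCount {v ∈ S | v.IsPositiveHyperbolic ∧ v.IsGood} : ℤ) -
    (orbitCount {v ∈ S | v.IsElliptic ∨ v.IsNegativeHyperbolic} : ℤ)

end PeriodicOrbit

end DoublySymmetric

end

/-! The composition `σ = ρ₁ ∘ ρ₂` of the two real structures is a symplectic involution preserving
`H`, so it respects the Hamiltonian flow, and it moves a simple doubly symmetric orbit along itself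
by half a period `h`. The map `ψ = σ ∘ φ_h` therefore fixes `v(0)`, and since `σ` is an involution,
even iterates of `ψ` are the flow itself. A `k`-fold cover has period `2k h`, so its unreduced
monodromy is `B ^ (2k)` with `B = dψ` at `v(0)` (`exists_root_of_monodromy`).

By Liouville's theorem (`form_flow`) `B` is symplectic, and it fixes `X_H`. Hence `B ^ k` induces a
map `C` of determinant one on the reduced plane, and the reduced monodromy is `C²`, with trace `(tr
C)² - 2 ≥ -2`. No doubly symmetric orbit is thus negative hyperbolic. A negative Euler
characteristic needs an orbit that is elliptic or negative hyperbolic, and this orbit must be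
elliptic. Determinant one and trace in `[-2, 2]` then put the eigenvalues on the unit circle. -/

namespace DoublySymmetric

/-! ### Invariance of a closed 2-form under a Hamiltonian flow, in a vector space -/

section Calculus

open Filter Topology

variable {E : Type*} [NormedAddCommGroup E] [NormedSpace ℝ E]

/-- The derivative of a field of alternating forms is alternating. -/
theorem fderiv_form_alternating {F : E → E →L[ℝ] E →L[ℝ] ℝ} {z : E}
    (hF : DifferentiableAt ℝ F z) (halt : ∀ᶠ y in 𝓝 z, ∀ u, F y u u = 0) (a u : E) :
    fderiv ℝ F z a u u = 0 := by
  have h1 : HasFDerivAt (fun y => F y u u) (((fderiv ℝ F z).flip u).flip u) z :=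
    (hF.hasFDerivAt.clm_apply (hasFDerivAt_const u z)).clm_apply (hasFDerivAt_const u z)
      |>.congr_fderiv (by ext; simp)
  have h2 : HasFDerivAt (fun y => F y u u) (0 : E →L[ℝ] ℝ) z :=
    (hasFDerivAt_const (0 : ℝ) z).congr_of_eventuallyEq (halt.mono fun y hy => hy u)
  simpa using DFunLike.congr_fun (h1.unique h2) a

theorem neg_of_alternating {G : E →L[ℝ] E →L[ℝ] ℝ} (h : ∀ u, G u u = 0) (u w : E) :
    G u w = -G w u := by
  have := h (u + w)
  simp only [map_add, add_apply, h] at this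
  linarith

/-- Along a flow line of a vector field that is Hamiltonian for a closed 2-form `F`, the
linearized flow preserves `F`. -/
theorem hasDerivAt_form_along_flow {Φ : ℝ × E → E} {F : E → E →L[ℝ] E →L[ℝ] ℝ} {X : E → E}
    {h : E → ℝ} {t₀ : ℝ} {y₀ : E} (hΦ : ContDiffAt ℝ 2 Φ (t₀, y₀))
    (hF : DifferentiableAt ℝ F (Φ (t₀, y₀))) (hX : DifferentiableAt ℝ X (Φ (t₀, y₀)))
    (hh : ContDiffAt ℝ 2 h (Φ (t₀, y₀)))
    (hflow : ∀ᶠ p in 𝓝 (t₀, y₀), HasDerivAt (fun t => Φ (t, p.2)) (X (Φ p)) p.1)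
    (hham : ∀ᶠ z in 𝓝 (Φ (t₀, y₀)), ∀ u, fderiv ℝ h z u = F z u (X z))
    (halt : ∀ᶠ z in 𝓝 (Φ (t₀, y₀)), ∀ u, F z u u = 0)
    (hclosed : ∀ u v w, fderiv ℝ F (Φ (t₀, y₀)) u v w + fderiv ℝ F (Φ (t₀, y₀)) v w u
      + fderiv ℝ F (Φ (t₀, y₀)) w u v = 0) (u w : E) :
    HasDerivAt (fun t => F (Φ (t, y₀)) (fderiv ℝ (fun y => Φ (t, y)) y₀ u)
      (fderiv ℝ (fun y => Φ (t, y)) y₀ w)) 0 t₀ := by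
  set p₀ : ℝ × E := (t₀, y₀) with hp₀
  set z₀ := Φ p₀ with hz₀
  have hline : HasDerivAt (fun t : ℝ => (t, y₀)) ((1, 0) : ℝ × E) t₀ :=
    (hasDerivAt_id t₀).prodMk (hasDerivAt_const t₀ y₀)
  have hdΦ : ∀ᶠ p in 𝓝 p₀, DifferentiableAt ℝ Φ p :=
    (hΦ.eventually (by simp)).mono fun p hp => hp.differentiableAt (by simp)
  have hL : DifferentiableAt ℝ (fderiv ℝ Φ) p₀ :=
    (hΦ.fderiv_right (m := 1) (by norm_num)).differentiableAt (by simp)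
  have hsymm : IsSymmSndFDerivAt ℝ Φ p₀ := hΦ.isSymmSndFDerivAt (by simp)
  have htime : (fun p => fderiv ℝ Φ p (1, 0)) =ᶠ[𝓝 p₀] fun p => X (Φ p) := by
    filter_upwards [hdΦ, hflow] with p hp hq
    have hl : HasDerivAt (fun t : ℝ => (t, p.2)) ((1, 0) : ℝ × E) p.1 :=
      (hasDerivAt_id p.1).prodMk (hasDerivAt_const p.1 p.2)
    exact (hp.hasFDerivAt.comp_hasDerivAt p.1 hl).unique hq
  -- The linearized flow equation: exchange the time and space derivatives of `Φ`, then
  -- differentiate the flow equation in space.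
  have hL' : ∀ v : E, fderiv ℝ (fderiv ℝ Φ) p₀ (1, 0) (0, v)
      = fderiv ℝ X z₀ (fderiv ℝ Φ p₀ (0, v)) := by
    intro v
    rw [hsymm.eq (1, 0) (0, v)]
    have h1 : HasFDerivAt (fun p => fderiv ℝ Φ p (1, 0))
        ((fderiv ℝ (fderiv ℝ Φ) p₀).flip (1, 0)) p₀ :=
      (hL.hasFDerivAt.clm_apply (hasFDerivAt_const _ p₀)).congr_fderiv (by ext <;> simp)
    have h2 := (hX.hasFDerivAt.comp p₀ hdΦ.self_of_nhds.hasFDerivAt).congr_of_eventuallyEq htime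
    simpa using DFunLike.congr_fun (h1.unique h2) (0, v)
  have hslice : ∀ t, DifferentiableAt ℝ Φ (t, y₀) → ∀ v : E,
      fderiv ℝ (fun y => Φ (t, y)) y₀ v = fderiv ℝ Φ (t, y₀) (0, v) := by
    intro t ht v
    have hl : HasFDerivAt (fun y => Φ (t, y))
        ((fderiv ℝ Φ (t, y₀)).comp (ContinuousLinearMap.inr ℝ ℝ E)) y₀ :=
      HasFDerivAt.comp y₀ (f := fun y => (t, y)) ht.hasFDerivAt (hasFDerivAt_prodMk_right t y₀)
    rw [hl.fderiv]
    simp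
  have hvar : ∀ v : E, HasDerivAt (fun t => fderiv ℝ (fun y => Φ (t, y)) y₀ v)
      (fderiv ℝ X z₀ (fderiv ℝ Φ p₀ (0, v))) t₀ := by
    intro v
    have hc : HasDerivAt (fun t => fderiv ℝ Φ (t, y₀)) (fderiv ℝ (fderiv ℝ Φ) p₀ (1, 0)) t₀ :=
      HasFDerivAt.comp_hasDerivAt (f := fun t : ℝ => (t, y₀)) t₀ hL.hasFDerivAt hline
    have h1 : HasDerivAt (fun t => fderiv ℝ Φ (t, y₀) (0, v))
        (fderiv ℝ (fderiv ℝ Φ) p₀ (1, 0) (0, v)) t₀ := by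
      simpa only [map_zero, add_zero] using hc.clm_apply (hasDerivAt_const t₀ ((0, v) : ℝ × E))
    rw [hL'] at h1
    refine h1.congr_of_eventuallyEq ?_
    exact (hline.continuousAt.eventually hdΦ).mono fun t ht => hslice t ht v
  have hpos : HasDerivAt (fun t => F (Φ (t, y₀))) (fderiv ℝ F z₀ (X z₀)) t₀ :=
    HasFDerivAt.comp_hasDerivAt (f := fun t => Φ (t, y₀)) (l := F) (l' := fderiv ℝ F z₀) t₀
      hF.hasFDerivAt hflow.self_of_nhds
  have hval := hslice t₀ hdΦ.self_of_nhds
  refine ((hpos.clm_apply (hvar u)).clm_apply (hvar w)).congr_deriv ?_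
  simp only [hval, add_apply, ← hp₀, ← hz₀]
  set U := fderiv ℝ Φ p₀ (0, u)
  set W := fderiv ℝ Φ p₀ (0, w)
  -- Differentiate `dh = F(·, X)`. Symmetry of the Hessian of `h` then relates the two terms of the
  -- derivative that contain `DX` to derivatives of `F`, and closedness cancels what remains.
  have hD : ∀ a v : E, fderiv ℝ (fderiv ℝ h) z₀ a v
      = fderiv ℝ F z₀ a v (X z₀) + F z₀ v (fderiv ℝ X z₀ a) := by
    intro a v
    have h1 : HasFDerivAt (fun z => fderiv ℝ h z v) ((fderiv ℝ (fderiv ℝ h) z₀).flip v) z₀ :=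
      (((hh.fderiv_right (m := 1) (by norm_num)).differentiableAt (by simp)).hasFDerivAt.clm_apply
        (hasFDerivAt_const v z₀)).congr_fderiv (by ext; simp)
    have h2 := ((hF.hasFDerivAt.clm_apply (hasFDerivAt_const v z₀)).clm_apply
      hX.hasFDerivAt).congr_of_eventuallyEq (hham.mono fun z hz => hz v)
    have h3 := DFunLike.congr_fun (h1.unique h2) a
    simp at h3
    linarith
  have hs : fderiv ℝ (fderiv ℝ h) z₀ W U = fderiv ℝ (fderiv ℝ h) z₀ U W :=
    (hh.isSymmSndFDerivAt (by simp)).eq W U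
  rw [hD, hD] at hs
  have hA := neg_of_alternating halt.self_of_nhds (fderiv ℝ X z₀ U) W
  have hB := neg_of_alternating (fderiv_form_alternating hF halt W) U (X z₀)
  have hC := hclosed (X z₀) U W
  linarith

end Calculus

/-! ### Area-preserving maps of a plane and linear symplectic reduction -/

section LinearAlgebra

variable {Q : Type*} [AddCommGroup Q] [Module ℝ Q]

/-- Pulling back an alternating form on a plane multiplies it by the determinant, and a nonzero form
can be cancelled. -/
theorem det_eq_one_of_area_preserving (hQ : Module.finrank ℝ Q = 2) (η : Q →ₗ[ℝ] Q →ₗ[ℝ] ℝ)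
    (halt : ∀ u, η u u = 0) (hne : η ≠ 0) (C : Q →ₗ[ℝ] Q)
    (hC : ∀ u w, η (C u) (C w) = η u w) : LinearMap.det C = 1 := by
  have : FiniteDimensional ℝ Q := Module.finite_of_finrank_pos (by omega)
  let b : Module.Basis (Fin 2) ℝ Q := Module.finBasisOfFinrankEq ℝ Q hQ
  have hexp : ∀ j, C (b j) = LinearMap.toMatrix b b C 0 j • b 0
      + LinearMap.toMatrix b b C 1 j • b 1 := by
    intro j
    rw [← b.sum_repr (C (b j)), Fin.sum_univ_two]
    simp [LinearMap.toMatrix_apply]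
  have hskew : η (b 1) (b 0) = -η (b 0) (b 1) := by
    have := halt (b 0 + b 1)
    simp only [map_add, LinearMap.add_apply, halt] at this
    linarith
  have hb : η (b 0) (b 1) ≠ 0 := by
    intro h0
    refine hne (b.ext fun i => b.ext fun j => ?_)
    fin_cases i <;> fin_cases j <;> simp [halt, hskew, h0]
  have h := hC (b 0) (b 1)
  rw [hexp, hexp] at h
  simp only [map_add, map_smul, LinearMap.add_apply, LinearMap.smul_apply, halt, hskew,
    smul_eq_mul] at h
  rw [← LinearMap.det_toMatrix b, Matrix.det_fin_two]
  refine mul_right_cancel₀ hb ?_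
  linear_combination h

/-- The trace of the Cayley–Hamilton identity. For determinant one it bounds the trace of a square
below by `-2`, which excludes negative hyperbolicity. -/
theorem trace_comp_self_eq (hQ : Module.finrank ℝ Q = 2) (C : Q →ₗ[ℝ] Q) :
    LinearMap.trace ℝ Q (C ∘ₗ C) = LinearMap.trace ℝ Q C ^ 2 - 2 * LinearMap.det C := by
  have : FiniteDimensional ℝ Q := Module.finite_of_finrank_pos (by omega)
  let b : Module.Basis (Fin 2) ℝ Q := Module.finBasisOfFinrankEq ℝ Q hQ
  rw [LinearMap.trace_eq_matrix_trace ℝ b, LinearMap.trace_eq_matrix_trace ℝ b,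
    ← LinearMap.det_toMatrix b, LinearMap.toMatrix_comp b b b, Matrix.trace_fin_two,
    Matrix.trace_fin_two, Matrix.det_fin_two, Matrix.mul_apply, Matrix.mul_apply,
    Fin.sum_univ_two, Fin.sum_univ_two]
  ring

theorem norm_eq_one_of_quadratic {t : ℝ} (h₁ : -2 ≤ t) (h₂ : t ≤ 2) {μ : ℂ}
    (h : μ ^ 2 - t * μ + 1 = 0) : ‖μ‖ = 1 := by
  have hre := congrArg Complex.re h
  have him := congrArg Complex.im h
  simp [pow_two] at hre him
  have hsq : μ.re * μ.re + μ.im * μ.im = 1 := by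
    -- Either `μ` is real, and `|t| ≤ 2` forces a double root `t / 2 = ±1`, or `μ` has real part `t
    -- / 2` and the real part of the equation says `|μ|² = 1`.
    have hy : μ.im * (2 * μ.re - t) = 0 := by linarith
    rcases mul_eq_zero.1 hy with hy | hy
    · rw [hy] at hre ⊢
      have : (μ.re - t / 2) ^ 2 = 0 := by nlinarith [sq_nonneg (μ.re - t / 2)]
      have : μ.re = t / 2 := by linarith [pow_eq_zero_iff (two_ne_zero) |>.1 this]
      rw [this] at hre ⊢
      linarith
    · have : t = 2 * μ.re := by linarith
      rw [this] at hre
      linarith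
  rw [Complex.norm_def, Complex.normSq_apply, hsq, Real.sqrt_one]

theorem norm_eigenvalue_eq_one (hQ : Module.finrank ℝ Q = 2) (N : Q →ₗ[ℝ] Q)
    (hdet : LinearMap.det N = 1) (h₁ : -2 ≤ LinearMap.trace ℝ Q N)
    (h₂ : LinearMap.trace ℝ Q N ≤ 2) (μ : ℂ)
    (hμ : Module.End.HasEigenvalue (LinearMap.baseChange ℂ N) μ) : ‖μ‖ = 1 := by
  have : FiniteDimensional ℝ Q := Module.finite_of_finrank_pos (by omega)
  let b : Module.Basis (Fin 2) ℝ Q := Module.finBasisOfFinrankEq ℝ Q hQ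
  have hroot := (Module.End.hasEigenvalue_iff_isRoot_charpoly _ _).1 hμ
  rw [LinearMap.charpoly_baseChange, ← LinearMap.charpoly_toMatrix N b,
    Matrix.charpoly_fin_two, LinearMap.det_toMatrix, hdet,
    ← LinearMap.trace_eq_matrix_trace ℝ b] at hroot
  refine norm_eq_one_of_quadratic h₁ h₂ ?_
  simpa [Polynomial.IsRoot] using hroot

variable {V : Type*} [AddCommGroup V] [Module ℝ V]

/-- A linear symplectic map fixing `X ≠ 0` in dimension four induces an area preserving map of
the symplectic quotient `X^⊥ / ⟨X⟩`. -/
theorem exists_reduced_map (hV : Module.finrank ℝ V = 4) (η : V →ₗ[ℝ] V →ₗ[ℝ] ℝ)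
    (halt : ∀ u, η u u = 0) (hnd : ∀ u, (∀ w, η w u = 0) → u = 0) {X : V} (hX : X ≠ 0)
    (E : Submodule ℝ V) (hE : ∀ u, u ∈ E ↔ η u X = 0) (B : V →ₗ[ℝ] V)
    (hB : ∀ u w, η (B u) (B w) = η u w) (hBX : B X = X) :
    Module.finrank ℝ (E ⧸ (Submodule.span ℝ {X}).submoduleOf E) = 2 ∧
    ∃ C : (E ⧸ (Submodule.span ℝ {X}).submoduleOf E) →ₗ[ℝ]
        (E ⧸ (Submodule.span ℝ {X}).submoduleOf E),
      LinearMap.det C = 1 ∧ ∀ (u : E) (hu : B u ∈ E),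
        C (Submodule.Quotient.mk u) = Submodule.Quotient.mk ⟨B u, hu⟩ := by
  have : FiniteDimensional ℝ V := Module.finite_of_finrank_pos (by omega)
  set P := (Submodule.span ℝ {X}).submoduleOf E with hP
  have hskew : ∀ u w, η u w = -η w u := by
    intro u w
    have := halt (u + w)
    simp only [map_add, LinearMap.add_apply, halt] at this
    linarith
  have hXE : X ∈ E := (hE X).2 (halt X)
  have hspan : Submodule.span ℝ {X} ≤ E := by
    rw [Submodule.span_singleton_le_iff_mem]; exact hXE
  obtain ⟨z, hz⟩ : ∃ z, η z X ≠ 0 := by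
    by_contra! h
    exact hX (hnd X h)
  have hfE : Module.finrank ℝ E = 3 := by
    have hker : E = LinearMap.ker (η.flip X) := by
      ext u; simp [hE]
    have h0 : η.flip X ≠ 0 := fun h0 => hz (by simpa using LinearMap.congr_fun h0 z)
    have := Module.Dual.finrank_ker_add_one_of_ne_zero h0
    rw [← hker] at this
    omega
  have hfP : Module.finrank ℝ P = 1 := by
    rw [(Submodule.submoduleOfEquivOfLe hspan).finrank_eq, finrank_span_singleton hX]
  have hfQ : Module.finrank ℝ (E ⧸ P) = 2 := by
    have := Submodule.finrank_quotient_add_finrank P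
    omega
  have hmemP : ∀ u : E, u ∈ P ↔ ∃ c : ℝ, c • X = (u : V) := by
    intro u
    rw [hP, Submodule.submoduleOf, Submodule.mem_comap, Submodule.mem_span_singleton]
    rfl
  have hBE : ∀ u ∈ E, B u ∈ E := fun u hu => by
    rw [hE] at hu ⊢
    rw [← hBX, hB, hu]
  have hvan : ∀ u : E, P ≤ LinearMap.ker ((η u).comp E.subtype) := by
    intro u p hp
    obtain ⟨c, hc⟩ := (hmemP p).1 hp
    simp [← hc, (hE u).1 u.2]
  let g : E →ₗ[ℝ] (E ⧸ P) →ₗ[ℝ] ℝ :=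
    { toFun := fun u => P.liftQ ((η u).comp E.subtype) (hvan u)
      map_add' := fun u w => Submodule.linearMap_qext _ (by ext; simp)
      map_smul' := fun c u => Submodule.linearMap_qext _ (by ext; simp) }
  have hg : P ≤ LinearMap.ker g := by
    intro p hp
    obtain ⟨c, hc⟩ := (hmemP p).1 hp
    refine Submodule.linearMap_qext _ ?_
    ext u
    simp [g, ← hc, hskew X u, (hE u).1 u.2]
  let η' : (E ⧸ P) →ₗ[ℝ] (E ⧸ P) →ₗ[ℝ] ℝ := P.liftQ g hg
  have hη' : ∀ u w : E, η' (Submodule.Quotient.mk u) (Submodule.Quotient.mk w) = η u w :=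
    fun u w => rfl
  let B' : E →ₗ[ℝ] E := B.restrict hBE
  let C : (E ⧸ P) →ₗ[ℝ] (E ⧸ P) := P.mapQ P B' (by
    intro p hp
    obtain ⟨c, hc⟩ := (hmemP p).1 hp
    refine (hmemP _).2 ⟨c, ?_⟩
    simp [B', ← hc, hBX])
  have hCmk : ∀ u : E, C (Submodule.Quotient.mk u) = Submodule.Quotient.mk (B' u) :=
    fun u => rfl
  refine ⟨hfQ, C, det_eq_one_of_area_preserving hfQ η' ?_ ?_ C ?_, fun u hu => rfl⟩
  · rintro ⟨u⟩
    exact halt u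
  · intro h0
    -- Were the induced form zero, each `w ∈ E` would be orthogonal to `E`. Since `E` and `z` span
    -- `V`, nondegeneracy would make `w` a multiple of `X`, against `dim E = 3`.
    have hEX : E ≤ Submodule.span ℝ {X} := by
      intro w hw
      have hiso : ∀ u ∈ E, η u w = 0 := fun u hu => by
        have := hη' ⟨u, hu⟩ ⟨w, hw⟩
        rw [h0] at this
        simpa using this.symm
      rw [Submodule.mem_span_singleton]
      refine ⟨η z w / η z X, (sub_eq_zero.1 (hnd _ fun u => ?_)).symm⟩
      have hu : u - (η u X / η z X) • z ∈ E := by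
        rw [hE]; simp; field_simp; simp
      have := hiso _ hu
      simp only [map_sub, map_smul, LinearMap.sub_apply, LinearMap.smul_apply, smul_eq_mul] at this ⊢
      rw [← this]
      ring
    have := Submodule.finrank_mono hEX
    rw [hfE, finrank_span_singleton hX] at this
    omega
  · rintro ⟨u⟩ ⟨w⟩
    exact hB u w

/-- If `N` is induced on the symplectic quotient by an even power of a linear symplectic map fixing
`X`, then `N` is the square of an area preserving map. -/
theorem exists_sqrt_of_reduced_even_pow (hV : Module.finrank ℝ V = 4) (η : V →ₗ[ℝ] V →ₗ[ℝ] ℝ)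
    (halt : ∀ u, η u u = 0) (hnd : ∀ u, (∀ w, η w u = 0) → u = 0) {X : V} (hX : X ≠ 0)
    (E : Submodule ℝ V) (hE : ∀ u, u ∈ E ↔ η u X = 0) (B : V →ₗ[ℝ] V)
    (hB : ∀ u w, η (B u) (B w) = η u w) (hBX : B X = X) (k : ℕ) (A : V →ₗ[ℝ] V)
    (hA : A = B ^ (2 * k))
    (N : (E ⧸ (Submodule.span ℝ {X}).submoduleOf E) →ₗ[ℝ]
        (E ⧸ (Submodule.span ℝ {X}).submoduleOf E))
    (hN : ∀ u : E, ∃ hu : A u ∈ E,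
      N (Submodule.Quotient.mk u) = Submodule.Quotient.mk ⟨A u, hu⟩) :
    Module.finrank ℝ (E ⧸ (Submodule.span ℝ {X}).submoduleOf E) = 2 ∧
    ∃ C : (E ⧸ (Submodule.span ℝ {X}).submoduleOf E) →ₗ[ℝ]
        (E ⧸ (Submodule.span ℝ {X}).submoduleOf E),
      LinearMap.det C = 1 ∧ N = C ∘ₗ C := by
  have hpowX : ∀ n : ℕ, (B ^ n) X = X := fun n => by
    induction n with
    | zero => rfl
    | succ n ih => rw [pow_succ', Module.End.mul_apply, ih, hBX]
  have hpow : ∀ (n : ℕ) u w, η ((B ^ n) u) ((B ^ n) w) = η u w := fun n u w => by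
    induction n with
    | zero => rfl
    | succ n ih => rw [pow_succ', Module.End.mul_apply, Module.End.mul_apply, hB, ih]
  -- The reduction is applied to `B ^ k`, whose square is `A`.
  obtain ⟨hfin, C, hdet, hC⟩ := exists_reduced_map hV η halt hnd hX E hE (B ^ k) (hpow k) (hpowX k)
  refine ⟨hfin, C, hdet, LinearMap.ext fun q => ?_⟩
  obtain ⟨u, rfl⟩ := Submodule.Quotient.mk_surjective _ q
  have hmem : ∀ u ∈ E, (B ^ k) u ∈ E := fun u hu => by
    rw [hE] at hu ⊢
    rw [← hu, ← hpow k u X, hpowX]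
  obtain ⟨hu, hNu⟩ := hN u
  rw [hNu, LinearMap.comp_apply, hC u (hmem _ u.2),
    hC ⟨(B ^ k) u, hmem _ u.2⟩ (hmem _ (hmem _ u.2))]
  refine congrArg _ (Subtype.ext ?_)
  simp only [hA, two_mul, pow_add, Module.End.mul_apply]

end LinearAlgebra

/-! ### The symplectic form and the Hamiltonian vector field in charts -/

section Chart

open Filter Topology

variable {M : Type*} [TopologicalSpace M] [ChartedSpace E4 M]

/-- The Hamiltonian vector field in the chart around `x₀`. -/
noncomputable def chartVF (Ω : SymplecticForm M) (H : M → ℝ) (x₀ : M) (y : E4) : E4 :=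
  mfderiv (𝓡 4) 𝓘(ℝ, E4) (extChartAt (𝓡 4) x₀) ((extChartAt (𝓡 4) x₀).symm y)
    (hamVF Ω H ((extChartAt (𝓡 4) x₀).symm y))

theorem chartVF_extChartAt (Ω : SymplecticForm M) (H : M → ℝ) {x₀ p : M}
    (hp : p ∈ (extChartAt (𝓡 4) x₀).source) :
    chartVF Ω H x₀ (extChartAt (𝓡 4) x₀ p)
      = (mfderiv (𝓡 4) 𝓘(ℝ, E4) (extChartAt (𝓡 4) x₀) p (hamVF Ω H p) : E4) := by
  have key : ∀ q, q = p → (mfderiv (𝓡 4) 𝓘(ℝ, E4) (extChartAt (𝓡 4) x₀) q (hamVF Ω H q) : E4)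
      = (mfderiv (𝓡 4) 𝓘(ℝ, E4) (extChartAt (𝓡 4) x₀) p (hamVF Ω H p) : E4) := by
    rintro q rfl
    rfl
  exact key _ ((extChartAt (𝓡 4) x₀).left_inv hp)

theorem chartForm_alternating (Ω : SymplecticForm M) (x₀ : M) (y u : E4) :
    chartForm Ω.form x₀ y u u = 0 :=
  Ω.alternating _ _

theorem contDiffAt_chartForm (Ω : SymplecticForm M) {x₀ : M} {y : E4}
    (hy : y ∈ (extChartAt (𝓡 4) x₀).target) : ContDiffAt ℝ ∞ (chartForm Ω.form x₀) y :=
  (Ω.smooth x₀).contDiffAt ((isOpen_extChartAt_target x₀).mem_nhds hy)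

variable [IsManifold (𝓡 4) ∞ M]

theorem mfderiv_symm_mfderiv_extChartAt {x₀ : M} {y : E4} (hy : y ∈ (extChartAt (𝓡 4) x₀).target)
    (X : TangentSpace (𝓡 4) ((extChartAt (𝓡 4) x₀).symm y)) :
    mfderiv 𝓘(ℝ, E4) (𝓡 4) (extChartAt (𝓡 4) x₀).symm y
      (mfderiv (𝓡 4) 𝓘(ℝ, E4) (extChartAt (𝓡 4) x₀) ((extChartAt (𝓡 4) x₀).symm y) X) = X := by
  have h := mfderivWithin_extChartAt_symm_comp_mfderiv_extChartAt (I := 𝓡 4) hy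
  rw [ModelWithCorners.range_eq_univ, mfderivWithin_univ] at h
  exact DFunLike.congr_fun h X

theorem mfderiv_mfderiv_symm_extChartAt {x₀ : M} {y : E4} (hy : y ∈ (extChartAt (𝓡 4) x₀).target)
    (u : E4) :
    mfderiv (𝓡 4) 𝓘(ℝ, E4) (extChartAt (𝓡 4) x₀) ((extChartAt (𝓡 4) x₀).symm y)
      (mfderiv 𝓘(ℝ, E4) (𝓡 4) (extChartAt (𝓡 4) x₀).symm y u) = u := by
  have h := mfderiv_extChartAt_comp_mfderivWithin_extChartAt_symm (I := 𝓡 4) hy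
  rw [ModelWithCorners.range_eq_univ, mfderivWithin_univ] at h
  exact DFunLike.congr_fun h u

theorem contMDiffAt_extChartAt_symm {x₀ : M} {y : E4} (hy : y ∈ (extChartAt (𝓡 4) x₀).target) :
    ContMDiffAt 𝓘(ℝ, E4) (𝓡 4) ∞ (extChartAt (𝓡 4) x₀).symm y :=
  (contMDiffOn_extChartAt_symm x₀).contMDiffAt ((isOpen_extChartAt_target x₀).mem_nhds hy)

theorem contDiffAt_comp_extChartAt_symm {H : M → ℝ} (hH : ContMDiff (𝓡 4) 𝓘(ℝ, ℝ) ∞ H) {x₀ : M}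
    {y : E4} (hy : y ∈ (extChartAt (𝓡 4) x₀).target) :
    ContDiffAt ℝ ∞ (H ∘ (extChartAt (𝓡 4) x₀).symm) y :=
  (hH.contMDiffAt.comp y (contMDiffAt_extChartAt_symm hy)).contDiffAt

theorem chartForm_chartVF (Ω : SymplecticForm M) {H : M → ℝ}
    (hH : ContMDiff (𝓡 4) 𝓘(ℝ, ℝ) ∞ H) {x₀ : M} {y : E4}
    (hy : y ∈ (extChartAt (𝓡 4) x₀).target) (u : E4) :
    chartForm Ω.form x₀ y u (chartVF Ω H x₀ y)
      = fderiv ℝ (H ∘ (extChartAt (𝓡 4) x₀).symm) y u := by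
  have h1 : chartForm Ω.form x₀ y u (chartVF Ω H x₀ y)
      = Ω.form _ (mfderiv 𝓘(ℝ, E4) (𝓡 4) (extChartAt (𝓡 4) x₀).symm y u)
        (mfderiv 𝓘(ℝ, E4) (𝓡 4) (extChartAt (𝓡 4) x₀).symm y
          (mfderiv (𝓡 4) 𝓘(ℝ, E4) (extChartAt (𝓡 4) x₀) ((extChartAt (𝓡 4) x₀).symm y)
            (hamVF Ω H ((extChartAt (𝓡 4) x₀).symm y)))) := rfl
  rw [h1, mfderiv_symm_mfderiv_extChartAt hy, ← hamVF_spec, ← mfderiv_eq_fderiv]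
  rw [mfderiv_comp y (hH.mdifferentiableAt (by simp))
    ((contMDiffAt_extChartAt_symm hy).mdifferentiableAt (by simp))]
  rfl

theorem chartForm_nondegenerate (Ω : SymplecticForm M) {x₀ : M} {y : E4}
    (hy : y ∈ (extChartAt (𝓡 4) x₀).target) {u : E4}
    (hu : ∀ w, chartForm Ω.form x₀ y w u = 0) : u = 0 := by
  have h0 : mfderiv 𝓘(ℝ, E4) (𝓡 4) (extChartAt (𝓡 4) x₀).symm y u = 0 := by
    refine Ω.nondegenerate _ _ fun w => ?_
    have := hu (mfderiv (𝓡 4) 𝓘(ℝ, E4) (extChartAt (𝓡 4) x₀) ((extChartAt (𝓡 4) x₀).symm y) w)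
    have h2 : Ω.form _ (mfderiv 𝓘(ℝ, E4) (𝓡 4) (extChartAt (𝓡 4) x₀).symm y
          (mfderiv (𝓡 4) 𝓘(ℝ, E4) (extChartAt (𝓡 4) x₀) ((extChartAt (𝓡 4) x₀).symm y) w))
        (mfderiv 𝓘(ℝ, E4) (𝓡 4) (extChartAt (𝓡 4) x₀).symm y u) = 0 := this
    rwa [mfderiv_symm_mfderiv_extChartAt hy] at h2
  rw [← mfderiv_mfderiv_symm_extChartAt hy u, h0]
  exact map_zero _

/-- The field solves a linear equation with invertible smooth coefficients and right side `dH`, and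
inversion of continuous linear maps is smooth. -/
theorem contDiffAt_chartVF (Ω : SymplecticForm M) {H : M → ℝ}
    (hH : ContMDiff (𝓡 4) 𝓘(ℝ, ℝ) ∞ H) {x₀ : M} {y : E4}
    (hy : y ∈ (extChartAt (𝓡 4) x₀).target) : ContDiffAt ℝ ∞ (chartVF Ω H x₀) y := by
  -- The sign swaps the two slots: `X_H` sits in the second one, and `G z X_H = dH`.
  let G : E4 → E4 →L[ℝ] E4 →L[ℝ] ℝ := fun z => -chartForm Ω.form x₀ z
  have hG : ContDiffAt ℝ ∞ G y := (contDiffAt_chartForm Ω hy).neg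
  have hGflip : ∀ z u w, G z u w = chartForm Ω.form x₀ z w u := fun z u w =>
    (neg_of_alternating (chartForm_alternating Ω x₀ z) w u).symm
  have hinv : ∀ z ∈ (extChartAt (𝓡 4) x₀).target, (G z).IsInvertible := by
    intro z hz
    have hinj : Function.Injective (G z).toLinearMap := by
      rw [← LinearMap.ker_eq_bot, LinearMap.ker_eq_bot']
      intro u hu
      exact chartForm_nondegenerate Ω hz fun w => by
        rw [← hGflip]
        exact DFunLike.congr_fun hu w
    have hdim : Module.finrank ℝ E4 = Module.finrank ℝ (E4 →L[ℝ] ℝ) := by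
      rw [← (LinearMap.toContinuousLinearMap : (E4 →ₗ[ℝ] ℝ) ≃ₗ[ℝ] _).finrank_eq]
      exact (Subspace.dual_finrank_eq (K := ℝ)).symm
    exact ⟨(LinearEquiv.ofInjectiveOfFinrankEq _ hinj hdim).toContinuousLinearEquiv, rfl⟩
  have hd : ContDiffAt ℝ ∞ (fderiv ℝ (H ∘ (extChartAt (𝓡 4) x₀).symm)) y :=
    (contDiffAt_comp_extChartAt_symm hH hy).fderiv_right (by simp)
  have hmain : ContDiffAt ℝ ∞
      (fun z => (G z).inverse (fderiv ℝ (H ∘ (extChartAt (𝓡 4) x₀).symm) z)) y :=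
    ((hinv y hy).contDiffAt_map_inverse.comp y hG).clm_apply hd
  refine hmain.congr_of_eventuallyEq ?_
  filter_upwards [(isOpen_extChartAt_target x₀).mem_nhds hy] with z hz
  have hGz : G z (chartVF Ω H x₀ z) = fderiv ℝ (H ∘ (extChartAt (𝓡 4) x₀).symm) z := by
    ext u
    rw [hGflip, chartForm_chartVF Ω hH hz u]
  rw [← hGz]
  exact ((hinv z hz).inverse_apply_eq.2 rfl).symm

/-- The Hamiltonian vector field of a smooth function is smooth. -/
theorem contMDiff_hamVF (Ω : SymplecticForm M) {H : M → ℝ}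
    (hH : ContMDiff (𝓡 4) 𝓘(ℝ, ℝ) ∞ H) :
    ContMDiff (𝓡 4) (𝓡 4).tangent 1 (fun x => (⟨x, hamVF Ω H x⟩ : TangentBundle (𝓡 4) M)) := by
  intro x₀
  rw [Bundle.contMDiffAt_section]
  have hc : ContMDiffAt (𝓡 4) 𝓘(ℝ, E4) 1 (chartVF Ω H x₀ ∘ extChartAt (𝓡 4) x₀) x₀ :=
    ((contDiffAt_chartVF Ω hH (mem_extChartAt_target x₀)).contMDiffAt.of_le (by simp)).comp x₀
      contMDiffAt_extChartAt
  refine hc.congr_of_eventuallyEq ?_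
  filter_upwards [extChartAt_source_mem_nhds (I := 𝓡 4) x₀] with p hp
  rw [Function.comp_apply, chartVF_extChartAt Ω H hp]
  rw [extChartAt_source] at hp
  have hb : p ∈ (trivializationAt E4 (TangentSpace (𝓡 4)) x₀).baseSet := by simpa using hp
  exact (Bundle.Trivialization.continuousLinearMapAt_apply_of_mem (R := ℝ) _ hb _).symm.trans
    (DFunLike.congr_fun (TangentBundle.continuousLinearMapAt_trivializationAt hp) _)

end Chart

/-! ### Liouville's theorem on the manifold -/

section Liouville

open Filter Topology

variable {M : Type*} [TopologicalSpace M] [ChartedSpace E4 M]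

theorem SymplecticForm.form_congr (Ω : SymplecticForm M) {p q : M} (h : q = p) (u w : E4) :
    Ω.form q u w = Ω.form p u w := by
  subst h
  rfl

section LocalFlow

variable {X : ∀ x : M, TangentSpace (𝓡 4) x} {a b : ℝ} {U : Set M} {φ : ℝ → M → M}

theorem IsLocalFlow.contMDiffAt (hφ : IsLocalFlow X a b U φ) {t : ℝ} (ht : t ∈ Set.Ioo a b)
    {x : M} (hx : x ∈ U) :
    ContMDiffAt (𝓘(ℝ, ℝ).prod (𝓡 4)) (𝓡 4) ∞ (fun p : ℝ × M => φ p.1 p.2) (t, x) :=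
  hφ.smooth.contMDiffAt ((isOpen_Ioo.prod hφ.isOpen).mem_nhds ⟨ht, hx⟩)

theorem IsLocalFlow.contMDiffAt_time (hφ : IsLocalFlow X a b U φ) {t : ℝ} (ht : t ∈ Set.Ioo a b)
    {x : M} (hx : x ∈ U) : ContMDiffAt (𝓡 4) (𝓡 4) ∞ (φ t) x :=
  ContMDiffAt.comp (f := fun y : M => (t, y)) (g := fun p : ℝ × M => φ p.1 p.2) x
    (hφ.contMDiffAt ht hx) (contMDiffAt_const.prodMk contMDiffAt_id)

theorem IsLocalFlow.hasMFDerivAt_time (hφ : IsLocalFlow X a b U φ) {t : ℝ}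
    (ht : t ∈ Set.Ioo a b) {x : M} (hx : x ∈ U) :
    HasMFDerivAt (𝓡 4) (𝓡 4) (φ t) x (mfderiv (𝓡 4) (𝓡 4) (φ t) x) :=
  ((hφ.contMDiffAt_time ht hx).mdifferentiableAt (by simp)).hasMFDerivAt

end LocalFlow

variable [IsManifold (𝓡 4) ∞ M]

theorem hasDerivAt_extChartAt_integralCurve {Ω : SymplecticForm M} {H : M → ℝ} {γ : ℝ → M}
    {s : Set ℝ} (hγ : IsMIntegralCurveOn γ (hamVF Ω H) s) {t : ℝ} (hs : s ∈ 𝓝 t) {x₁ : M}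
    (hx₁ : γ t ∈ (extChartAt (𝓡 4) x₁).source) :
    HasDerivAt (fun r => extChartAt (𝓡 4) x₁ (γ r))
      (chartVF Ω H x₁ (extChartAt (𝓡 4) x₁ (γ t))) t := by
  have h1 := (hγ t (mem_of_mem_nhds hs)).hasMFDerivAt hs
  have h2 : HasMFDerivAt (𝓡 4) 𝓘(ℝ, E4) (extChartAt (𝓡 4) x₁) (γ t)
      (mfderiv (𝓡 4) 𝓘(ℝ, E4) (extChartAt (𝓡 4) x₁) (γ t)) := by
    rw [extChartAt_source] at hx₁
    exact (mdifferentiableAt_extChartAt hx₁).hasMFDerivAt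
  have h3 : HasFDerivAt (fun r => extChartAt (𝓡 4) x₁ (γ r))
      ((1 : ℝ →L[ℝ] ℝ).smulRight (chartVF Ω H x₁ (extChartAt (𝓡 4) x₁ (γ t)))) t := by
    refine (hasMFDerivAt_iff_hasFDerivAt.1 (h2.comp t h1)).congr_fderiv ?_
    refine ContinuousLinearMap.ext fun r : ℝ => ?_
    rw [chartVF_extChartAt Ω H hx₁]
    exact (mfderiv (𝓡 4) 𝓘(ℝ, E4) (extChartAt (𝓡 4) x₁) (γ t)).map_smul (r : ℝ) (hamVF Ω H (γ t))
  simpa using h3.hasDerivAt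

/-- Liouville's theorem, infinitesimally: the derivative of the pullback of the symplectic form
under a Hamiltonian flow vanishes. -/
theorem hasDerivAt_form_flow {Ω : SymplecticForm M} {H : M → ℝ}
    (hH : ContMDiff (𝓡 4) 𝓘(ℝ, ℝ) ∞ H) {a b : ℝ} {U : Set M} {φ : ℝ → M → M}
    (hφ : IsLocalFlow (hamVF Ω H) a b U φ) {x : M} (hx : x ∈ U) {t₀ : ℝ}
    (ht₀ : t₀ ∈ Set.Ioo a b) (u w : TangentSpace (𝓡 4) x) :
    HasDerivAt (fun t => Ω.form (φ t x) (mfderiv (𝓡 4) (𝓡 4) (φ t) x u)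
      (mfderiv (𝓡 4) (𝓡 4) (φ t) x w)) 0 t₀ := by
  set x₁ := φ t₀ x with hx₁
  set e₀ := extChartAt (𝓡 4) x with he₀
  set e₁ := extChartAt (𝓡 4) x₁ with he₁
  set y₀ : E4 := e₀ x with hy₀
  have hy₀t : y₀ ∈ e₀.target := mem_extChartAt_target x
  have hinv : e₀.symm y₀ = x := extChartAt_to_inv x
  -- The flow read in a chart at the initial point and a chart at the point reached at time `t₀`.
  -- The latter serves only for `t` near `t₀`, which suffices for a derivative.
  let Φ : ℝ × E4 → E4 := fun p => e₁ (φ p.1 (e₀.symm p.2))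
  have hinner : ContMDiffAt 𝓘(ℝ, ℝ × E4) (𝓡 4) ∞
      (fun p : ℝ × E4 => φ p.1 (e₀.symm p.2)) (t₀, y₀) := by
    have h1 : ContMDiffAt 𝓘(ℝ, ℝ × E4) 𝓘(ℝ, ℝ) ∞ (fun p : ℝ × E4 => p.1) (t₀, y₀) :=
      contDiff_fst.contMDiff.contMDiffAt
    have h2 : ContMDiffAt 𝓘(ℝ, ℝ × E4) 𝓘(ℝ, E4) ∞ (fun p : ℝ × E4 => p.2) (t₀, y₀) :=
      contDiff_snd.contMDiff.contMDiffAt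
    have h3 : ContMDiffAt 𝓘(ℝ, ℝ × E4) (𝓡 4) ∞ (fun p : ℝ × E4 => e₀.symm p.2) (t₀, y₀) :=
      ContMDiffAt.comp (f := fun p : ℝ × E4 => p.2) (t₀, y₀)
        (contMDiffAt_extChartAt_symm hy₀t) h2
    have h4 := h1.prodMk h3
    have h5 : ContMDiffAt (𝓘(ℝ, ℝ).prod (𝓡 4)) (𝓡 4) ∞ (fun p : ℝ × M => φ p.1 p.2)
        (t₀, e₀.symm y₀) := by
      rw [hinv]
      exact hφ.contMDiffAt ht₀ hx
    exact ContMDiffAt.comp (f := fun p : ℝ × E4 => (p.1, e₀.symm p.2))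
      (g := fun p : ℝ × M => φ p.1 p.2) (t₀, y₀) h5 h4
  have hz₀ : Φ (t₀, y₀) = e₁ x₁ := by
    show e₁ (φ t₀ (e₀.symm y₀)) = e₁ x₁
    rw [hinv]
  have hzt : Φ (t₀, y₀) ∈ e₁.target := hz₀ ▸ mem_extChartAt_target x₁
  have hΦ : ContDiffAt ℝ ∞ Φ (t₀, y₀) := by
    refine ContMDiffAt.contDiffAt ?_
    have h6 : ContMDiffAt (𝓡 4) 𝓘(ℝ, E4) ∞ e₁ (φ t₀ (e₀.symm y₀)) := by
      rw [hinv]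
      exact contMDiffAt_extChartAt
    exact ContMDiffAt.comp (f := fun p : ℝ × E4 => φ p.1 (e₀.symm p.2)) (t₀, y₀) h6 hinner
  have htarget : ∀ᶠ z in 𝓝 (Φ (t₀, y₀)), z ∈ e₁.target :=
    (isOpen_extChartAt_target x₁).mem_nhds hzt
  have hflow : ∀ᶠ p in 𝓝 (t₀, y₀),
      HasDerivAt (fun t => Φ (t, p.2)) (chartVF Ω H x₁ (Φ p)) p.1 := by
    have hsrc : ∀ᶠ p : ℝ × E4 in 𝓝 (t₀, y₀), φ p.1 (e₀.symm p.2) ∈ e₁.source := by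
      refine hinner.continuousAt.preimage_mem_nhds ((isOpen_extChartAt_source x₁).mem_nhds ?_)
      show φ t₀ (e₀.symm y₀) ∈ _
      rw [hinv]
      exact mem_extChartAt_source x₁
    have hU : ∀ᶠ p : ℝ × E4 in 𝓝 (t₀, y₀), e₀.symm p.2 ∈ U := by
      have hc : ContinuousAt (fun p : ℝ × E4 => e₀.symm p.2) (t₀, y₀) :=
        ContinuousAt.comp (f := fun p : ℝ × E4 => p.2)
          (contMDiffAt_extChartAt_symm hy₀t).continuousAt continuousAt_snd
      refine hc.preimage_mem_nhds (hφ.isOpen.mem_nhds ?_)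
      show e₀.symm y₀ ∈ U
      rwa [hinv]
    have hI : ∀ᶠ p : ℝ × E4 in 𝓝 (t₀, y₀), p.1 ∈ Set.Ioo a b :=
      continuousAt_fst.preimage_mem_nhds (isOpen_Ioo.mem_nhds ht₀)
    filter_upwards [hsrc, hU, hI] with p hp1 hp2 hp3
    exact hasDerivAt_extChartAt_integralCurve (hφ.isIntegralCurveOn _ hp2)
      (isOpen_Ioo.mem_nhds hp3) hp1
  have key := hasDerivAt_form_along_flow (hΦ.of_le ENat.LEInfty.out)
    ((contDiffAt_chartForm Ω hzt).differentiableAt (by simp))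
    ((contDiffAt_chartVF Ω hH hzt).differentiableAt (by simp))
    ((contDiffAt_comp_extChartAt_symm hH hzt).of_le ENat.LEInfty.out) hflow
    (htarget.mono fun z hz v => (chartForm_chartVF Ω hH hz v).symm)
    (Eventually.of_forall fun z v => chartForm_alternating Ω x₁ z v)
    (Ω.closed x₁ _ hzt) (mfderiv (𝓡 4) 𝓘(ℝ, E4) e₀ x u) (mfderiv (𝓡 4) 𝓘(ℝ, E4) e₀ x w)
  refine key.congr_of_eventuallyEq ?_
  have hcurve : ContinuousAt (fun t => φ t x) t₀ :=
    (((hφ.isIntegralCurveOn x hx) t₀ ht₀).hasMFDerivAt (isOpen_Ioo.mem_nhds ht₀)).continuousAt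
  have hline : ContinuousAt (fun t : ℝ => (t, y₀)) t₀ := by fun_prop
  filter_upwards [hcurve.preimage_mem_nhds (extChartAt_source_mem_nhds (I := 𝓡 4) x₁),
    isOpen_Ioo.mem_nhds ht₀,
    hline.eventually ((hΦ.of_le (m := 1) (by simp)).eventually (by simp))] with t hts htI htΦ
  have htx : Φ (t, y₀) = e₁ (φ t x) := by
    show e₁ (φ t (e₀.symm y₀)) = e₁ (φ t x)
    rw [hinv]
  have hd0 : HasMFDerivAt (𝓡 4) 𝓘(ℝ, E4) e₀ x (mfderiv (𝓡 4) 𝓘(ℝ, E4) e₀ x) :=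
    (contMDiffAt_extChartAt (n := 1)).mdifferentiableAt (by simp) |>.hasMFDerivAt
  have hd1 : HasMFDerivAt 𝓘(ℝ, E4) 𝓘(ℝ, E4) (fun y => Φ (t, y)) (e₀ x)
      (fderiv ℝ (fun y => Φ (t, y)) y₀) :=
    (DifferentiableAt.comp (f := fun y : E4 => (t, y)) y₀ (htΦ.differentiableAt (by simp))
      (by fun_prop)).hasFDerivAt.hasMFDerivAt
  have htt : Φ (t, y₀) ∈ e₁.target := by
    rw [htx]
    exact e₁.map_source hts
  have hd2 : HasMFDerivAt 𝓘(ℝ, E4) (𝓡 4) e₁.symm (Φ (t, y₀))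
      (mfderiv 𝓘(ℝ, E4) (𝓡 4) e₁.symm (Φ (t, y₀))) :=
    ((contMDiffAt_extChartAt_symm htt).mdifferentiableAt (by simp)).hasMFDerivAt
  have hcomp := HasMFDerivAt.comp x (g := e₁.symm) hd2 (hd1.comp x hd0)
  have heq : φ t =ᶠ[𝓝 x] e₁.symm ∘ (fun y => Φ (t, y)) ∘ e₀ := by
    filter_upwards [extChartAt_source_mem_nhds (I := 𝓡 4) x,
      (hφ.contMDiffAt_time htI hx).continuousAt.preimage_mem_nhds
        ((isOpen_extChartAt_source (I := 𝓡 4) x₁).mem_nhds hts)] with z hz1 hz2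
    show φ t z = e₁.symm (e₁ (φ t (e₀.symm (e₀ z))))
    rw [e₀.left_inv hz1, e₁.left_inv hz2]
  have hm := (hcomp.congr_of_eventuallyEq heq).mfderiv
  have hpt : e₁.symm (Φ (t, y₀)) = φ t x := by
    rw [htx, e₁.left_inv hts]
  rw [hm]
  exact (Ω.form_congr hpt _ _).symm

/-- Hamiltonian flows preserve the symplectic form. -/
theorem form_flow {Ω : SymplecticForm M} {H : M → ℝ}
    (hH : ContMDiff (𝓡 4) 𝓘(ℝ, ℝ) ∞ H) {a b : ℝ} {U : Set M} {φ : ℝ → M → M}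
    (hφ : IsLocalFlow (hamVF Ω H) a b U φ) {x : M} (hx : x ∈ U) {t : ℝ}
    (ht : t ∈ Set.Ioo a b) (u w : TangentSpace (𝓡 4) x) :
    Ω.form (φ t x) (mfderiv (𝓡 4) (𝓡 4) (φ t) x u) (mfderiv (𝓡 4) (𝓡 4) (φ t) x w)
      = Ω.form x u w := by
  have hd := fun s (hs : s ∈ Set.Ioo a b) => hasDerivAt_form_flow hH hφ hx hs u w
  have h0 := isOpen_Ioo.is_const_of_deriv_eq_zero isPreconnected_Ioo
    (fun s hs => (hd s hs).differentiableAt.differentiableWithinAt)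
    (fun s hs => (hd s hs).deriv) ht hφ.zero_mem
  refine h0.trans ?_
  -- The constant value is read off at time zero; its differential requires `φ 0 = id` on a
  -- neighbourhood.
  have hid : φ 0 =ᶠ[𝓝 x] id := by
    filter_upwards [hφ.isOpen.mem_nhds hx] with z hz using hφ.map_zero z hz
  have hm := ((hasMFDerivAt_id (I := 𝓡 4) x).congr_of_eventuallyEq hid).mfderiv
  show Ω.form (φ 0 x) (mfderiv (𝓡 4) (𝓡 4) (φ 0) x u) (mfderiv (𝓡 4) (𝓡 4) (φ 0) x w) = _
  rw [hm]
  exact Ω.form_congr (hφ.map_zero x hx) u w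

end Liouville

/-! ### The symplectic involution and a root of the monodromy -/

section Symmetry

open Filter Topology

variable {M : Type*} [TopologicalSpace M] [ChartedSpace E4 M]

/-- A symplectic involution that preserves the Hamiltonian. -/
structure IsHamiltonianInvolution (Ω : SymplecticForm M) (H : M → ℝ) (σ : M → M) : Prop where
  smooth : ContMDiff (𝓡 4) (𝓡 4) ∞ σ
  involutive : Function.Involutive σ
  symplectic : ∀ (x : M) (u w : TangentSpace (𝓡 4) x),
    Ω.form (σ x) (mfderiv (𝓡 4) (𝓡 4) σ x u) (mfderiv (𝓡 4) (𝓡 4) σ x w) = Ω.form x u w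
  invariant : ∀ x, H (σ x) = H x

/-- The composition of two commuting real structures is a symplectic involution. -/
theorem IsRealStructure.isHamiltonianInvolution_comp {Ω : SymplecticForm M} {H : M → ℝ}
    {ρ₁ ρ₂ : M → M} (h₁ : IsRealStructure Ω ρ₁) (h₂ : IsRealStructure Ω ρ₂)
    (hcomm : ρ₁ ∘ ρ₂ = ρ₂ ∘ ρ₁) (hH₁ : H ∘ ρ₁ = H) (hH₂ : H ∘ ρ₂ = H) :
    IsHamiltonianInvolution Ω H (ρ₁ ∘ ρ₂) where
  smooth := h₁.smooth.comp h₂.smooth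
  involutive := fun x => by
    rw [hcomm]
    show ρ₂ (ρ₁ (ρ₂ (ρ₁ x))) = x
    rw [show ρ₁ (ρ₂ (ρ₁ x)) = ρ₂ (ρ₁ (ρ₁ x)) from congrFun hcomm (ρ₁ x), h₁.involutive,
      h₂.involutive]
  symplectic := fun x u w => by
    rw [mfderiv_comp x (h₁.smooth.mdifferentiableAt (by simp))
      (h₂.smooth.mdifferentiableAt (by simp))]
    exact (h₁.anti (ρ₂ x) _ _).trans ((congrArg Neg.neg (h₂.anti x u w)).trans (neg_neg _))
  invariant := fun x => (congrFun hH₁ (ρ₂ x)).trans (congrFun hH₂ x)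

/-- `Ω` and `H` determine the field, and `σ` preserves both. As `dσ` is onto, it is enough to test
against vectors `dσ u`. -/
theorem IsHamiltonianInvolution.mfderiv_hamVF {Ω : SymplecticForm M} {H : M → ℝ} {σ : M → M}
    (hσ : IsHamiltonianInvolution Ω H σ) (hH : ContMDiff (𝓡 4) 𝓘(ℝ, ℝ) ∞ H) (x : M) :
    mfderiv (𝓡 4) (𝓡 4) σ x (hamVF Ω H x) = hamVF Ω H (σ x) := by
  let D : E4 →L[ℝ] E4 := mfderiv (𝓡 4) (𝓡 4) σ x
  have hinj : Function.Injective D.toLinearMap := by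
    rw [← LinearMap.ker_eq_bot, LinearMap.ker_eq_bot']
    intro u hu
    refine Ω.nondegenerate x u fun w => ?_
    rw [← hσ.symplectic x w u, show mfderiv (𝓡 4) (𝓡 4) σ x u = 0 from hu]
    simp
  have hsurj : Function.Surjective D.toLinearMap := LinearMap.injective_iff_surjective.1 hinj
  rw [← sub_eq_zero]
  refine Ω.nondegenerate _ _ fun w => ?_
  obtain ⟨u, rfl⟩ := hsurj w
  have h1 := (hσ.symplectic x u (hamVF Ω H x)).trans (hamVF_spec Ω H x u).symm
  have h2 : differential H x u = differential H (σ x) (mfderiv (𝓡 4) (𝓡 4) σ x u) := by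
    have hc : H ∘ σ = H := funext hσ.invariant
    have hm := mfderiv_comp x (hH.mdifferentiableAt (x := σ x) (by simp))
      (hσ.smooth.mdifferentiableAt (x := x) (by simp))
    have h3 : mfderiv (𝓡 4) 𝓘(ℝ, ℝ) (H ∘ σ) x u = mfderiv (𝓡 4) 𝓘(ℝ, ℝ) H x u := by
      rw [hc]
    rw [hm] at h3
    exact h3.symm
  exact (map_sub (Ω.form (σ x) _) _ _).trans
    (sub_eq_zero.2 ((h1.trans h2).trans (hamVF_spec Ω H (σ x) _)))

theorem IsHamiltonianInvolution.isMIntegralCurveOn {Ω : SymplecticForm M} {H : M → ℝ} {σ : M → M}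
    (hσ : IsHamiltonianInvolution Ω H σ) (hH : ContMDiff (𝓡 4) 𝓘(ℝ, ℝ) ∞ H) {γ : ℝ → M}
    {s : Set ℝ} (hγ : IsMIntegralCurveOn γ (hamVF Ω H) s) :
    IsMIntegralCurveOn (fun t => σ (γ t)) (hamVF Ω H) s := by
  intro t ht
  have h1 := ((hσ.smooth.mdifferentiableAt (x := γ t) (by simp)).hasMFDerivAt).comp_hasMFDerivWithinAt
    t (hγ t ht)
  rw [← hσ.mfderiv_hamVF hH]
  refine h1.congr_mfderiv (ContinuousLinearMap.ext fun r : ℝ => ?_)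
  exact (mfderiv (𝓡 4) (𝓡 4) σ (γ t)).map_smul (r : ℝ) (hamVF Ω H (γ t))

theorem IsHamiltonianInvolution.isMIntegralCurveOn_iterate {Ω : SymplecticForm M} {H : M → ℝ}
    {σ : M → M} (hσ : IsHamiltonianInvolution Ω H σ) (hH : ContMDiff (𝓡 4) 𝓘(ℝ, ℝ) ∞ H)
    {γ : ℝ → M} {s : Set ℝ} (hγ : IsMIntegralCurveOn γ (hamVF Ω H) s) (n : ℕ) :
    IsMIntegralCurveOn (fun t => σ^[n] (γ t)) (hamVF Ω H) s := by
  induction n with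
  | zero => exact hγ
  | succ n ih =>
    simp only [Function.iterate_succ_apply']
    exact hσ.isMIntegralCurveOn hH ih

theorem hasMFDerivAt_iterate_of_fixed {ψ : M → M} {x : M} (hx : ψ x = x) {B : E4 →L[ℝ] E4}
    (hB : HasMFDerivAt (𝓡 4) (𝓡 4) ψ x B) (n : ℕ) :
    HasMFDerivAt (𝓡 4) (𝓡 4) ψ^[n] x (B ^ n : E4 →L[ℝ] E4) := by
  induction n with
  | zero => exact hasMFDerivAt_id x
  | succ n ih =>
    have key : ∀ q, q = x → HasMFDerivAt (𝓡 4) (𝓡 4) ψ q B := by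
      rintro q rfl
      exact hB
    have h1 := (key (ψ^[n] x) (Function.iterate_fixed hx n)).comp x ih
    rw [Function.iterate_succ', pow_succ']
    exact h1

variable [T2Space M] [IsManifold (𝓡 4) ∞ M]

theorem eqOn_of_isMIntegralCurveOn {Ω : SymplecticForm M} {H : M → ℝ}
    (hH : ContMDiff (𝓡 4) 𝓘(ℝ, ℝ) ∞ H) {γ γ' : ℝ → M} {a b t₀ : ℝ} (ht₀ : t₀ ∈ Set.Ioo a b)
    (hγ : IsMIntegralCurveOn γ (hamVF Ω H) (Set.Ioo a b))
    (hγ' : IsMIntegralCurveOn γ' (hamVF Ω H) (Set.Ioo a b)) (h : γ t₀ = γ' t₀) :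
    Set.EqOn γ γ' (Set.Ioo a b) :=
  isMIntegralCurveOn_Ioo_eqOn_of_contMDiff_boundaryless ht₀ (contMDiff_hamVF Ω hH) hγ hγ' h

theorem IsLocalFlow.eq_integralCurve {Ω : SymplecticForm M} {H : M → ℝ}
    (hH : ContMDiff (𝓡 4) 𝓘(ℝ, ℝ) ∞ H) {a b : ℝ} {U : Set M} {φ : ℝ → M → M}
    (hφ : IsLocalFlow (hamVF Ω H) a b U φ) {γ : ℝ → M} (hγ : IsMIntegralCurve γ (hamVF Ω H))
    {s t : ℝ} (hs : γ s ∈ U) (ht : t ∈ Set.Ioo a b) : φ t (γ s) = γ (t + s) := by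
  refine eqOn_of_isMIntegralCurveOn hH hφ.zero_mem (hφ.isIntegralCurveOn _ hs)
    ((hγ.comp_add s).isMIntegralCurveOn _) ?_ ht
  simp [hφ.map_zero _ hs]

/-- The flow at time `n h` in terms of the iterates of `σ ∘ φ_h`. -/
theorem IsHamiltonianInvolution.flow_nat_mul {Ω : SymplecticForm M} {H : M → ℝ} {σ : M → M}
    (hσ : IsHamiltonianInvolution Ω H σ) (hH : ContMDiff (𝓡 4) 𝓘(ℝ, ℝ) ∞ H) {a b : ℝ} {U : Set M}
    {φ : ℝ → M → M} (hφ : IsLocalFlow (hamVF Ω H) a b U φ) {h : ℝ} (hh : 0 < h) {y : M} (n : ℕ)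
    (hy : ∀ i ≤ n, (fun z => σ (φ h z))^[i] y ∈ U) (hn : n * h < b) :
    φ (n * h) y = σ^[n] ((fun z => σ (φ h z))^[n] y) := by
  induction n with
  | zero => simpa using hφ.map_zero y (hy 0 le_rfl)
  | succ n ih =>
    push_cast at hn
    have ih' := ih (fun i hi => hy i (by omega)) (by linarith)
    set ψ := fun z => σ (φ h z) with hψ
    have ha := hφ.zero_mem.1
    have hnn : (0 : ℝ) ≤ n * h := by positivity
    -- Since `U` need not be `σ`-invariant, `σ` is not commuted past `φ`. Instead two integral
    -- curves that agree at time zero are compared at time `h`.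
    have hα : IsMIntegralCurveOn (fun t => φ (t + n * h) y) (hamVF Ω H)
        (Set.Ioo a (b - n * h)) :=
      ((hφ.isIntegralCurveOn y (hy 0 (by omega))).comp_add (n * h)).mono fun t ht =>
        ⟨by linarith [ht.1], by linarith [ht.2]⟩
    have hβ : IsMIntegralCurveOn (fun t => σ^[n] (φ t (ψ^[n] y))) (hamVF Ω H)
        (Set.Ioo a (b - n * h)) :=
      hσ.isMIntegralCurveOn_iterate hH ((hφ.isIntegralCurveOn _ (hy n (by omega))).mono
        (Set.Ioo_subset_Ioo_right (by linarith))) n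
    have h0 : (0 : ℝ) ∈ Set.Ioo a (b - n * h) := ⟨ha, by linarith⟩
    have heq := eqOn_of_isMIntegralCurveOn hH h0 hα hβ
      (by simp only [zero_add]; rw [ih', hφ.map_zero _ (hy n (by omega))])
      (show h ∈ Set.Ioo a (b - n * h) from ⟨by linarith, by linarith⟩)
    simp only at heq
    push_cast
    rw [show ((n : ℝ) + 1) * h = h + n * h by ring, heq, Function.iterate_succ_apply,
      Function.iterate_succ_apply']
    simp only [hψ]
    rw [hσ.involutive]

/-- Half of the monodromy of an orbit `γ` of period `2 h` that is invariant under `σ` up to a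
shift by `h`: the monodromy over the time `n h`, with `n` even, is the `n`-th power of a linear
symplectic map that fixes the Hamiltonian vector. -/
theorem exists_root_of_monodromy {Ω : SymplecticForm M} {H : M → ℝ} {σ : M → M}
    (hσ : IsHamiltonianInvolution Ω H σ) (hH : ContMDiff (𝓡 4) 𝓘(ℝ, ℝ) ∞ H) {a b : ℝ} {U : Set M}
    {φ : ℝ → M → M} (hφ : IsLocalFlow (hamVF Ω H) a b U φ) {γ : ℝ → M}
    (hγ : IsMIntegralCurve γ (hamVF Ω H)) {h : ℝ} (hh : 0 < h)
    (hsym : ∀ t, σ (γ t) = γ (t + h)) (hγU : γ 0 ∈ U) {n : ℕ} (hn : Even n) (hn0 : 0 < n)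
    (hnb : n * h < b) {A : E4 →L[ℝ] E4} (hA : HasMFDerivAt (𝓡 4) (𝓡 4) (φ (n * h)) (γ 0) A) :
    ∃ B : E4 →L[ℝ] E4, A = B ^ n ∧ B (hamVF Ω H (γ 0)) = hamVF Ω H (γ 0) ∧
      ∀ u w : E4, Ω.form (γ 0) (B u) (B w) = Ω.form (γ 0) u w := by
  set x := γ 0 with hx
  have hn1 : (1 : ℝ) ≤ n := by exact_mod_cast hn0
  have hhI : h ∈ Set.Ioo a b := ⟨by linarith [hφ.zero_mem.1], by nlinarith⟩
  let ψ : M → M := fun z => σ (φ h z)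
  have hψγ : ∀ s, γ s ∈ U → ψ (γ s) = γ s := by
    intro s hs
    show σ (φ h (γ s)) = γ s
    rw [hφ.eq_integralCurve hH hγ hs hhI, add_comm, ← hsym, hσ.involutive]
  have hψx : ψ x = x := hψγ 0 hγU
  let B : E4 →L[ℝ] E4 :=
    (mfderiv (𝓡 4) (𝓡 4) σ (φ h x)).comp (mfderiv (𝓡 4) (𝓡 4) (φ h) x)
  have hB : HasMFDerivAt (𝓡 4) (𝓡 4) ψ x B :=
    (hσ.smooth.mdifferentiableAt (by simp)).hasMFDerivAt.comp x (hφ.hasMFDerivAt_time hhI hγU)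
  refine ⟨B, ?_, ?_, ?_⟩
  -- `ψ` is defined by a local flow, but its first `n` iterates keep points near the fixed point `x`
  -- inside `U`.
  · have hev : ∀ᶠ y in 𝓝 x, ∀ i ≤ n, ψ^[i] y ∈ U := by
      have : ∀ i, ∀ᶠ y in 𝓝 x, ψ^[i] y ∈ U := fun i =>
        (hasMFDerivAt_iterate_of_fixed hψx hB i).continuousAt.preimage_mem_nhds
          (hφ.isOpen.mem_nhds (by rwa [Function.iterate_fixed hψx]))
      exact ((Set.finite_Iic n).eventually_all).2 fun i _ => this i
    have heq : φ (n * h) =ᶠ[𝓝 x] ψ^[n] := by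
      filter_upwards [hev] with y hy
      rw [hσ.flow_nat_mul hH hφ hh n hy hnb, hσ.involutive.iterate_even hn]
      rfl
    exact hasMFDerivAt_unique hA
      ((hasMFDerivAt_iterate_of_fixed hψx hB n).congr_of_eventuallyEq heq)
  -- `ψ` fixes the curve pointwise near time zero, hence `B` fixes its velocity.
  · have hγ0 := hγ 0
    have h1 := HasMFDerivAt.comp 0 (g := ψ) hB hγ0
    have heq : γ =ᶠ[𝓝 0] ψ ∘ γ := by
      filter_upwards [hγ0.continuousAt.preimage_mem_nhds (hφ.isOpen.mem_nhds hγU)] with s hs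
      exact (hψγ s hs).symm
    have h2 := hasMFDerivAt_unique hγ0 (h1.congr_of_eventuallyEq heq)
    have h3 := DFunLike.congr_fun h2 (1 : ℝ)
    have h4 : ((1 : ℝ) • (hamVF Ω H x : E4)) = B ((1 : ℝ) • (hamVF Ω H x : E4)) := h3
    rw [one_smul] at h4
    exact h4.symm
  · intro u w
    exact (Ω.form_congr hψx _ _).symm.trans
      ((hσ.symplectic (φ h x) _ _).trans (form_flow hH hφ hγU hhI u w))

end Symmetry

/-! ### The reduced monodromy of a doubly symmetric orbit is a square -/

section ReducedMonodromy

variable {M : Type*} [TopologicalSpace M] [ChartedSpace E4 M] [T2Space M] [IsManifold (𝓡 4) ∞ M]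

namespace PeriodicOrbit

variable {Ω : SymplecticForm M} {H : M → ℝ}

/-- At a zero of the field, uniqueness would make the orbit constant. -/
theorem hamVF_ne_zero (hH : ContMDiff (𝓡 4) 𝓘(ℝ, ℝ) ∞ H) (v : PeriodicOrbit Ω H) :
    hamVF Ω H (v.curve 0) ≠ 0 := by
  intro h0
  obtain ⟨t, ht⟩ := v.nonconstant
  exact ht (congrFun (isMIntegralCurve_Ioo_eq_of_contMDiff_boundaryless (t₀ := 0)
    (contMDiff_hamVF Ω hH) v.isIntegralCurve (isMIntegralCurve_const h0) rfl) t)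

/-- A simple doubly symmetric orbit is shifted by half its period under `ρ₁ ∘ ρ₂`. -/
theorem IsSimpleDoublySymmetric.comp_apply_curve {ρ₁ ρ₂ : M → M}
    (hσ : IsHamiltonianInvolution Ω H (ρ₁ ∘ ρ₂)) (hH : ContMDiff (𝓡 4) 𝓘(ℝ, ℝ) ∞ H)
    {w : PeriodicOrbit Ω H} (hw : w.IsSimpleDoublySymmetric ρ₁ ρ₂) (t : ℝ) :
    (ρ₁ ∘ ρ₂) (w.curve t) = w.curve (t + w.τ / 2) := by
  have h1 : IsMIntegralCurve (fun t => (ρ₁ ∘ ρ₂) (w.curve t)) (hamVF Ω H) :=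
    isMIntegralCurve_iff_isMIntegralCurveOn.2
      (hσ.isMIntegralCurveOn hH (w.isIntegralCurve.isMIntegralCurveOn _))
  refine congrFun (isMIntegralCurve_Ioo_eq_of_contMDiff_boundaryless (t₀ := 0)
    (contMDiff_hamVF Ω hH) h1 (w.isIntegralCurve.comp_add (w.τ / 2)) ?_) t
  show ρ₁ (ρ₂ (w.curve 0)) = w.curve (0 + w.τ / 2)
  rw [hw.doubly]
  -- By periodicity `w(-τ/2) = w(τ/2)`, so `ρ₁` fixes the midpoint of the orbit.
  have h2 := hw.symmetric (-(w.τ / 2))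
  rw [neg_neg] at h2
  rw [h2, ← w.periodic (-(w.τ / 2))]
  congr 1
  ring

/-- The reduced monodromy of a doubly symmetric orbit is the square of an area preserving map. -/
theorem IsReducedMonodromy.exists_sqrt {ρ₁ ρ₂ : M → M}
    (hσ : IsHamiltonianInvolution Ω H (ρ₁ ∘ ρ₂)) (hH : ContMDiff (𝓡 4) 𝓘(ℝ, ℝ) ∞ H)
    {v : PeriodicOrbit Ω H} (hv : v.IsDoublySymmetric ρ₁ ρ₂)
    {N : ReducedSpace Ω H (v.curve 0) →ₗ[ℝ] ReducedSpace Ω H (v.curve 0)}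
    (hN : v.IsReducedMonodromy N) :
    Module.finrank ℝ (ReducedSpace Ω H (v.curve 0)) = 2 ∧
    ∃ C : ReducedSpace Ω H (v.curve 0) →ₗ[ℝ] ReducedSpace Ω H (v.curve 0),
      LinearMap.det C = 1 ∧ N = C ∘ₗ C := by
  obtain ⟨k, w, ⟨hk, hcurve, hτ⟩, hw⟩ := hv
  obtain ⟨A, ⟨a, b, U, φ, hφ, hτI, hU, hA⟩, hNA⟩ := hN
  have hsym : ∀ t, (ρ₁ ∘ ρ₂) (v.curve t) = v.curve (t + w.τ / 2) := by
    rw [hcurve]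
    exact hw.comp_apply_curve hσ hH
  have hτ' : v.τ = (2 * k : ℕ) * (w.τ / 2) := by
    rw [hτ]
    push_cast
    ring
  rw [hτ'] at hτI hA
  obtain ⟨B, hAB, hBX, hBΩ⟩ := exists_root_of_monodromy hσ hH hφ v.isIntegralCurve
    (half_pos w.τ_pos) hsym hU (even_two_mul k) (by omega) hτI.2 hA
  let B' : TangentSpace (𝓡 4) (v.curve 0) →ₗ[ℝ] TangentSpace (𝓡 4) (v.curve 0) := B.toLinearMap
  have hAB' : A.toLinearMap = B' ^ (2 * k) := by
    rw [hAB]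
    exact ContinuousLinearMap.toLinearMap_pow B (2 * k)
  let η : TangentSpace (𝓡 4) (v.curve 0) →ₗ[ℝ] TangentSpace (𝓡 4) (v.curve 0) →ₗ[ℝ] ℝ :=
    LinearMap.mk₂ ℝ (fun u w => Ω.form (v.curve 0) u w)
      (by intros; simp) (by intros; simp) (by intros; simp) (by intros; simp)
  have hE : ∀ u, u ∈ energyTangent H (v.curve 0) ↔ η u (hamVF Ω H (v.curve 0)) = 0 := fun u =>
    Eq.congr_left (hamVF_spec Ω H (v.curve 0) u)
  have hdim : Module.finrank ℝ (TangentSpace (𝓡 4) (v.curve 0)) = 4 :=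
    finrank_euclideanSpace_fin (𝕜 := ℝ) (n := 4)
  exact exists_sqrt_of_reduced_even_pow hdim η (Ω.alternating _)
    (Ω.nondegenerate _) (v.hamVF_ne_zero hH) (energyTangent H _) hE B' hBΩ hBX k
    A.toLinearMap hAB' N hNA

end PeriodicOrbit

end ReducedMonodromy

end DoublySymmetric

/-! ### Conclusion -/

open DoublySymmetric in
theorem corollaryE {M : Type*} [TopologicalSpace M] [T2Space M] [ChartedSpace E4 M]
    [IsManifold (𝓡 4) ∞ M]
    (Ω : SymplecticForm M) (ρ₁ ρ₂ : M → M)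
    (hρ₁ : IsRealStructure Ω ρ₁) (hρ₂ : IsRealStructure Ω ρ₂)
    (hne : ρ₁ ≠ ρ₂) (hcomm : ρ₁ ∘ ρ₂ = ρ₂ ∘ ρ₁)
    (H : M → ℝ) (hH : ContMDiff (𝓡 4) 𝓘(ℝ, ℝ) ∞ H)
    (hHρ₁ : H ∘ ρ₁ = H) (hHρ₂ : H ∘ ρ₂ = H)
    (S : Set (PeriodicOrbit Ω H))
    (hfin : (Quotient.mk (PeriodicOrbit.sameOrbit Ω H) '' S).Finite)
    (hS : ∀ v ∈ S, v.IsDoublySymmetric ρ₁ ρ₂)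
    (hχ : PeriodicOrbit.sftEulerChar S < 0) :
    ∃ v ∈ S, v.IsElliptic ∧ v.IsStable := by
  have hσ : IsHamiltonianInvolution Ω H (ρ₁ ∘ ρ₂) :=
    hρ₁.isHamiltonianInvolution_comp hρ₂ hcomm hHρ₁ hHρ₂
  obtain ⟨v, hvS, hv⟩ : {v ∈ S | v.IsElliptic ∨ v.IsNegativeHyperbolic}.Nonempty := by
    rw [Set.nonempty_iff_ne_empty]
    intro h0
    rw [PeriodicOrbit.sftEulerChar, h0] at hχ
    simp [PeriodicOrbit.orbitCount] at hχ
    omega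
  -- Both alternatives give the upper bound; the lower bound comes from `N` being a square.
  obtain ⟨N, hN, htr⟩ : ∃ N, v.IsReducedMonodromy N ∧
      LinearMap.trace ℝ (ReducedSpace Ω H (v.curve 0)) N ≤ 2 := by
    rcases hv with ⟨N, hN, -, h⟩ | ⟨N, hN, h⟩
    · exact ⟨N, hN, h⟩
    · exact ⟨N, hN, by linarith⟩
  obtain ⟨hfin, C, hdet, rfl⟩ := hN.exists_sqrt hσ hH (hS v hvS)
  have htr' : -2 ≤ LinearMap.trace ℝ (ReducedSpace Ω H (v.curve 0)) (C ∘ₗ C) := by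
    rw [trace_comp_self_eq hfin, hdet]
    nlinarith [sq_nonneg (LinearMap.trace ℝ (ReducedSpace Ω H (v.curve 0)) C)]
  exact ⟨v, hvS, ⟨_, hN, htr', htr⟩, _, hN,
    norm_eigenvalue_eq_one hfin _ (by rw [LinearMap.det_comp, hdet, one_mul]) htr' htr⟩
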